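/- Call a metric space $(K,\rho)$ \emph{metrically convex} if for all $t_1,t_2\in K$ and $r_1,r_2\ge 0$ the closed balls $B_K(t_1,r_1)$ and $B_K(t_2,r_2)$ intersect if and only if $\rho(t_1,t_2)\le r_1+r_2$, and \emph{almost metrically convex} if for all $t,\tau\in K$ and $\eta>0$ there is a curve of length at most $a=\rho(t,\tau)+\eta$ joining $t$ and $\tau$, that is, a $1$-Lipschitz map $\phi\colon[0,a]\to K$ with $\phi(0)=t$ and $\phi(a)=\tau$. Consider the real space $L_1[0,1]$ and let $M=\{f\in L_1[0,1] : |f|=1 \text{ a.e.}\}$. Then $M$ is closed in $L_1[0,1]$, and if $f\ne g$ are in $M$ and $0<s<1$, then $sf+(1-s)g\notin M$. There exist sequences $(x_n^*)_{n\ge1}$ in the unit sphere of $L_\infty[0,1]$ that are total, i.e. such that $f\in L_1[0,1]$ and $x_n^*(f)=\int_0^1 x_n^*f=0$ for all $n$ imply $f=0$. For every such sequence, $$ |||f||| = \|f\|_{L_1} + \Bigl(\sum_{n=1}^\infty 2^{-n}|x_n^*(f)|^2\Bigr)^{1/2} $$ is a strictly convex norm on $L_1[0,1]$ that is equivalent to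 $\|\cdot\|_{L_1}$, and $M$ with the metric $\rho(f,g)=|||f-g|||$ is a complete, noncompact, almost metrically convex metric space that is not metrically convex. -/

import Mathlib

open MeasureTheory
open scoped ENNReal

/-- A metric space is metrically convex if two closed balls (of radii `r₁, r₂ ≥ 0`) intersect
if and only if the distance of their centres is at most `r₁ + r₂`. -/
def MetricallyConvex (K : Type*) [MetricSpace K] : Prop :=
  ∀ t₁ t₂ : K, ∀ r₁ r₂ : ℝ, 0 ≤ r₁ → 0 ≤ r₂ →
    ((Metric.closedBall t₁ r₁ ∩ Metric.closedBall t₂ r₂).Nonempty ↔ dist t₁ t₂ ≤ r₁ + r₂)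

/-- A metric space is almost metrically convex if any two points `t, τ` can be joined, for every
`η > 0`, by a curve of length at most `a = ρ(t, τ) + η`, i.e. by a `1`-Lipschitz map
`φ : [0, a] → K` with `φ 0 = t` and `φ a = τ`. -/
def AlmostMetricallyConvex (K : Type*) [MetricSpace K] : Prop :=
  ∀ t τ : K, ∀ η : ℝ, 0 < η → ∃ φ : ℝ → K,
    LipschitzOnWith 1 φ (Set.Icc 0 (dist t τ + η)) ∧ φ 0 = t ∧ φ (dist t τ + η) = τ

noncomputable section

namespace LipDaugavet

/-- Lebesgue measure on `[0,1]`. -/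
abbrev lebesgue01 : Measure ℝ := volume.restrict (Set.Icc 0 1)

/-- The real Banach space `L₁[0,1]`. -/
abbrev L1 : Type := Lp ℝ 1 lebesgue01

/-- The real Banach space `L_∞[0,1]`. -/
abbrev LInf : Type := Lp ℝ ∞ lebesgue01

/-- The functional on `L₁[0,1]` given by an element of `L_∞[0,1]`. -/
def pairing (x : LInf) (f : L1) : ℝ := ∫ t, x t * f t ∂lebesgue01

/-- A sequence in the unit sphere of `L_∞[0,1] = L₁[0,1]^*` that is total, i.e. separates the
points of `L₁[0,1]`. -/
structure TotalSeq where
  /-- the terms of the sequence -/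
  seq : ℕ → LInf
  norm_seq : ∀ n, ‖seq n‖ = 1
  total : ∀ f : L1, (∀ n, pairing (seq n) f = 0) → f = 0

/-- `|||f||| = ‖f‖₁ + (∑_{n ≥ 1} 2⁻ⁿ |xₙ(f)|²)^{1/2}`; the sequence is indexed from `0`, so the
`n`-th term has weight `2^{-(n+1)}`. -/
def renorm (x : TotalSeq) (f : L1) : ℝ :=
  ‖f‖ + Real.sqrt (∑' n : ℕ, (1 / 2 : ℝ) ^ (n + 1) * |pairing (x.seq n) f| ^ 2)

/-- `L₁[0,1]` as a vector space, to be normed by `renorm x`. -/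
def RenormedL1 (_x : TotalSeq) : Type := L1

instance (x : TotalSeq) : AddCommGroup (RenormedL1 x) := inferInstanceAs (AddCommGroup L1)

instance (x : TotalSeq) : Module ℝ (RenormedL1 x) := inferInstanceAs (Module ℝ L1)

/-- The identity map onto `L₁[0,1]` with its usual norm. -/
def RenormedL1.toL1 (x : TotalSeq) : RenormedL1 x ≃ₗ[ℝ] L1 := LinearEquiv.refl ℝ L1

instance (x : TotalSeq) : Norm (RenormedL1 x) := ⟨fun f => renorm x (RenormedL1.toL1 x f)⟩

theorem pairing_eq (x : LInf) (f : L1) :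
    pairing x f = (ContinuousLinearMap.mul ℝ ℝ).lpPairing lebesgue01 ∞ 1 x f := by
  rw [ContinuousLinearMap.lpPairing_eq_integral]
  rfl

theorem pairing_add (x : LInf) (f g : L1) : pairing x (f + g) = pairing x f + pairing x g := by
  simp only [pairing_eq, map_add]

theorem pairing_smul (x : LInf) (c : ℝ) (f : L1) : pairing x (c • f) = c * pairing x f := by
  simp only [pairing_eq, map_smul, smul_eq_mul]

theorem summable_renorm (x : TotalSeq) (f : L1) :
    Summable fun n : ℕ => (1 / 2 : ℝ) ^ (n + 1) * |pairing (x.seq n) f| ^ 2 := by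
  set C := ‖(ContinuousLinearMap.mul ℝ ℝ).lpPairing lebesgue01 ∞ 1‖ * ‖f‖ with hC
  have hb : ∀ n, |pairing (x.seq n) f| ≤ C := by
    intro n
    rw [pairing_eq, ← Real.norm_eq_abs]
    have h := ((ContinuousLinearMap.mul ℝ ℝ).lpPairing lebesgue01 ∞ 1).le_opNorm₂ (x.seq n) f
    rwa [x.norm_seq n, mul_one] at h
  have hs : Summable fun n : ℕ => (1 / 2 : ℝ) ^ (n + 1) * C ^ 2 :=
    ((summable_nat_add_iff 1).2 summable_geometric_two).mul_right _
  refine Summable.of_nonneg_of_le (fun n => by positivity) (fun n => ?_) hs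
  gcongr
  exact hb n

theorem renorm_smul (x : TotalSeq) (c : ℝ) (f : L1) : renorm x (c • f) = |c| * renorm x f := by
  have h : ∀ n : ℕ, (1 / 2 : ℝ) ^ (n + 1) * |pairing (x.seq n) (c • f)| ^ 2
      = c ^ 2 * ((1 / 2 : ℝ) ^ (n + 1) * |pairing (x.seq n) f| ^ 2) := by
    intro n
    rw [pairing_smul, abs_mul, mul_pow, sq_abs c]
    ring
  simp only [renorm, h]
  rw [tsum_mul_left, Real.sqrt_mul (sq_nonneg c), Real.sqrt_sq_eq_abs, norm_smul,
    Real.norm_eq_abs]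
  ring

theorem renorm_add_le (x : TotalSeq) (f g : L1) :
    renorm x (f + g) ≤ renorm x f + renorm x g := by
  let a : L1 → ℕ → ℝ := fun f n => Real.sqrt ((1 / 2 : ℝ) ^ (n + 1)) * |pairing (x.seq n) f|
  have ha : ∀ f n, (1 / 2 : ℝ) ^ (n + 1) * |pairing (x.seq n) f| ^ 2 = a f n ^ (2 : ℝ) := by
    intro f n
    rw [Real.rpow_two, mul_pow, Real.sq_sqrt (by positivity)]
  have h0 : ∀ f n, 0 ≤ a f n := fun f n => by positivity
  have hs : ∀ f, Summable fun n => a f n ^ (2 : ℝ) := fun f => by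
    simpa only [ha] using summable_renorm x f
  have hM := Real.Lp_add_le_tsum_of_nonneg (one_le_two) (h0 f) (h0 g) (hs f) (hs g)
  have hle : ∑' n, a (f + g) n ^ (2 : ℝ) ≤ ∑' n, (a f n + a g n) ^ (2 : ℝ) := by
    refine (hs (f + g)).tsum_le_tsum (fun n => ?_) hM.1
    refine Real.rpow_le_rpow (h0 _ n) ?_ zero_le_two
    change _ * |_| ≤ _ * |_| + _ * |_|
    rw [← mul_add, pairing_add]
    gcongr
    exact abs_add_le _ _
  simp only [renorm, ha]
  have h2 := Real.sqrt_le_sqrt hle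
  rw [← Real.sqrt_eq_rpow, ← Real.sqrt_eq_rpow, ← Real.sqrt_eq_rpow] at hM
  linarith [norm_add_le f g, hM.2]

theorem norm_le_renorm (x : TotalSeq) (f : L1) : ‖f‖ ≤ renorm x f :=
  le_add_of_nonneg_right (Real.sqrt_nonneg _)

theorem renormedL1_core (x : TotalSeq) : NormedSpace.Core ℝ (RenormedL1 x) where
  norm_nonneg f := (norm_nonneg (RenormedL1.toL1 x f)).trans (norm_le_renorm x _)
  norm_smul c f := renorm_smul x c f
  norm_triangle f g := renorm_add_le x f g
  norm_eq_zero_iff f := by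
    constructor
    · intro h
      have h1 : ‖RenormedL1.toL1 x f‖ ≤ 0 := (norm_le_renorm x _).trans h.le
      exact (RenormedL1.toL1 x).map_eq_zero_iff.1 (norm_le_zero_iff.1 h1)
    · rintro rfl
      have h := renorm_smul x 0 0
      rw [zero_smul, abs_zero, zero_mul] at h
      exact h

instance (x : TotalSeq) : NormedAddCommGroup (RenormedL1 x) :=
  NormedAddCommGroup.ofCore (renormedL1_core x)

instance (x : TotalSeq) : NormedSpace ℝ (RenormedL1 x) :=
  NormedSpace.ofCore (renormedL1_core x)

/-- `{f ∈ L₁[0,1] : |f| = 1 a.e.}`. -/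
def unimodular : Set L1 := {f | ∀ᵐ t ∂lebesgue01, |f t| = 1}

/-- The set of unimodular functions, with the metric `ρ(f, g) = |||f - g|||` induced by
`renorm x`. -/
abbrev M (x : TotalSeq) : Type := {f : RenormedL1 x // RenormedL1.toL1 x f ∈ unimodular}

end LipDaugavet

end

/-!
The renormed space is `‖f‖ + ‖T f‖` with `T` an injective operator into `ℓ₂`, so it inherits strict
convexity from `ℓ₂`. In a strictly convex space a metrically convex set contains the midpoints of
its points, but `0`, the midpoint of `1` and `-1`, is not unimodular. As a compact almost metrically
convex space is metrically convex, it remains to join `f` and `g` in `M` by almost shortest curves.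

Let `h = g - f`, and let `H` be the density with respect to Lebesgue measure of the `ℓ₂`-valued
measure `A ↦ T (1_A h)`. The function `p = (|h|, H)` is Bochner integrable, hence uniformly
approximable by functions with countably many values. The distribution functions of Lebesgue
measure conditioned on the level sets of such an approximation glue together to a function `Φ` that
is uniformly distributed on `[0,1]` and independent of the approximation. Therefore the integral of
`p` over `Φ⁻¹(B)` differs from `|B| ∫ p` by at most `ε |B|`, and the curve
`s ↦ f + 1_{Φ ≤ s} (g - f)` of unimodular functions moves at almost constant speed in both
summands of the norm.
-/

section MetricConvexity

variable {K : Type*} [MetricSpace K]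

theorem AlmostMetricallyConvex.of_unitInterval
    (h : ∀ t τ : K, ∀ η > 0, ∃ γ : ℝ → K, γ 0 = t ∧ γ 1 = τ ∧
      ∀ s u, 0 ≤ s → s ≤ u → u ≤ 1 → dist (γ s) (γ u) ≤ (u - s) * (dist t τ + η)) :
    AlmostMetricallyConvex K := by
  intro t τ η hη
  obtain ⟨γ, hγ0, hγ1, hγ⟩ := h t τ η hη
  have ha : 0 < dist t τ + η := by positivity
  set a := dist t τ + η
  have hdist : ∀ r r', 0 ≤ r → r ≤ r' → r' ≤ a → dist (γ (r / a)) (γ (r' / a)) ≤ r' - r := by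
    intro r r' hr hrr' hr'
    have hspeed := hγ (r / a) (r' / a) (by positivity) (by gcongr) ((div_le_one ha).2 hr')
    rwa [← sub_div, div_mul_cancel₀ _ ha.ne'] at hspeed
  refine ⟨fun r => γ (r / a), LipschitzOnWith.of_dist_le_mul fun r hr r' hr' => ?_,
    by simpa using hγ0, by simpa [ha.ne'] using hγ1⟩
  rw [NNReal.coe_one, one_mul]
  rcases le_total r r' with hrr' | hrr'
  · rw [dist_comm r, Real.dist_eq]
    exact (hdist r r' hr.1 hrr' hr'.2).trans (le_abs_self _)
  · rw [dist_comm (γ _), Real.dist_eq]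
    exact (hdist r' r hr'.1 hrr' hr.2).trans (le_abs_self _)

theorem AlmostMetricallyConvex.metricallyConvex [CompactSpace K]
    (h : AlmostMetricallyConvex K) : MetricallyConvex K := by
  intro t₁ t₂ r₁ r₂ hr₁ hr₂
  constructor
  · rintro ⟨z, hz₁, hz₂⟩
    exact (dist_triangle_left t₁ t₂ z).trans (add_le_add hz₁ hz₂)
  intro hd
  obtain ⟨z, -, hz⟩ := isCompact_univ.exists_isMinOn (s := Set.univ)
    (f := fun z : K => max (dist z t₁ - r₁) (dist z t₂ - r₂)) ⟨t₁, trivial⟩ (by fun_prop)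
  suffices hle : max (dist z t₁ - r₁) (dist z t₂ - r₂) ≤ 0 from
    ⟨z, sub_nonpos.1 (max_le_iff.1 hle).1, sub_nonpos.1 (max_le_iff.1 hle).2⟩
  refine le_of_forall_pos_le_add fun η hη => ?_
  obtain ⟨φ, hφ, hφ0, hφa⟩ := h t₁ t₂ η hη
  have ha : 0 ≤ dist t₁ t₂ + η := by positivity
  set a := dist t₁ t₂ + η
  set m := min r₁ a
  have hm : m ∈ Set.Icc 0 a := ⟨le_min hr₁ ha, min_le_right _ _⟩
  have hm₁ : dist (φ m) t₁ ≤ m := by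
    simpa [hφ0, abs_of_nonneg hm.1] using hφ.dist_le_mul m hm 0 ⟨le_rfl, ha⟩
  have hm₂ : dist (φ m) t₂ ≤ a - m := by
    simpa [hφa, dist_comm m, Real.dist_eq, abs_of_nonneg (sub_nonneg.2 hm.2)] using
      hφ.dist_le_mul m hm a ⟨ha, le_rfl⟩
  have ham : a - m ≤ r₂ + η := by grind
  refine (hz (Set.mem_univ (φ m))).trans (max_le ?_ ?_)
  · linarith [min_le_left r₁ a]
  · linarith

end MetricConvexity

theorem MetricallyConvex.midpoint_mem {E : Type*} [NormedAddCommGroup E] [NormedSpace ℝ E]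
    [StrictConvexSpace ℝ E] {S : Set E} (h : MetricallyConvex S) {a b : E} (ha : a ∈ S)
    (hb : b ∈ S) : midpoint ℝ a b ∈ S := by
  obtain ⟨⟨z, hz⟩, hza, hzb⟩ := (h ⟨a, ha⟩ ⟨b, hb⟩ (dist a b / 2) (dist a b / 2) (by positivity)
    (by positivity)).2 (add_halves (dist a b)).ge
  replace hza : dist z a ≤ dist a b / 2 := hza
  replace hzb : dist z b ≤ dist a b / 2 := hzb
  rw [dist_comm] at hza
  have htri := dist_triangle a z b
  rwa [← eq_midpoint_of_dist_eq_half (x := a) (y := z) (z := b) (by linarith) (by linarith)]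

namespace LipDaugavet

open ProbabilityTheory Set

theorem strictConvexSpace_of_norm_eq_add {E F G : Type*} [NormedAddCommGroup E] [NormedSpace ℝ E]
    [NormedAddCommGroup F] [NormedSpace ℝ F] [NormedAddCommGroup G] [NormedSpace ℝ G]
    [StrictConvexSpace ℝ G] (S : E →ₗ[ℝ] F) {T : E →ₗ[ℝ] G} (hT : Function.Injective T)
    (hnorm : ∀ f, ‖f‖ = ‖S f‖ + ‖T f‖) : StrictConvexSpace ℝ E := by
  refine StrictConvexSpace.of_norm_add fun f g hf hg hfg => ?_
  refine hT.sameRay_map_iff.1 (sameRay_iff_norm_add.2 ?_)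
  rw [hnorm] at hf hg hfg
  rw [map_add, map_add] at hfg
  linarith [norm_add_le (S f) (S g), norm_add_le (T f) (T g)]

theorem eq_zero_of_denseRange_of_norming {V ι 𝓕 : Type*} [NormedAddCommGroup V] [FunLike 𝓕 V ℝ]
    [AddMonoidHomClass 𝓕 V ℝ] {d : ι → V} (hd : DenseRange d) {φ : ι → 𝓕}
    (hle : ∀ i v, |φ i v| ≤ ‖v‖) (hnorm : ∀ i, φ i (d i) = ‖d i‖) {v : V}
    (hv : ∀ i, φ i v = 0) : v = 0 := by
  have hdist : ∀ w, ‖w‖ ≤ ‖w - v‖ := fun w =>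
    hd.induction_on w (isClosed_le continuous_norm (by fun_prop)) fun i => by
      simpa [hv, hnorm] using hle i (d i - v)
  simpa using hdist v

/-! ### Classes of integrable functions -/

section Lp

variable {α E : Type*} [MeasurableSpace α] {μ : Measure α} [NormedAddCommGroup E]

theorem norm_integral_mul_le (x : Lp ℝ ∞ μ) (f : Lp ℝ 1 μ) :
    ‖∫ t, x t * f t ∂μ‖ ≤ ‖x‖ * ‖f‖ := by
  calc ‖∫ t, x t * f t ∂μ‖ = ‖∫ t, (x • f : Lp ℝ 1 μ) t ∂μ‖ :=
        congrArg _ (integral_congr_ae (Lp.coeFn_lpSMul x f)).symm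
    _ ≤ ‖(x • f : Lp ℝ 1 μ)‖ := by
        rw [L1.norm_eq_integral_norm]
        exact norm_integral_le_integral_norm _
    _ ≤ ‖x‖ * ‖f‖ := Lp.norm_smul_le x f

theorem exists_norm_eq_one_integral_mul_eq_norm [NeZero μ] (f : Lp ℝ 1 μ) :
    ∃ x : Lp ℝ ∞ μ, ‖x‖ = 1 ∧ ∫ t, x t * f t ∂μ = ‖f‖ := by
  let σ : α → ℝ := fun t => if 0 ≤ f t then 1 else -1
  have hσ_meas : Measurable σ :=
    .ite (measurableSet_le measurable_const (Lp.stronglyMeasurable f).measurable)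
      measurable_const measurable_const
  have hσ_norm : ∀ t, ‖σ t‖ = 1 := fun t => by
    simp only [σ]
    split_ifs <;> simp
  have hσ_mul : ∀ t, σ t * f t = ‖f t‖ := fun t => by
    simp only [σ]
    split_ifs with h
    · rw [one_mul, Real.norm_of_nonneg h]
    · rw [neg_one_mul, Real.norm_of_nonpos (not_le.1 h).le]
  have hσ : MemLp σ ∞ μ :=
    memLp_top_of_bound hσ_meas.aestronglyMeasurable 1 (.of_forall fun t => (hσ_norm t).le)
  refine ⟨hσ.toLp, ?_, ?_⟩
  · rw [Lp.norm_toLp, ← eLpNorm_norm]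
    simp only [hσ_norm]
    rw [eLpNorm_const _ ENNReal.top_ne_zero (NeZero.ne μ)]
    simp
  · rw [L1.norm_eq_integral_norm]
    refine integral_congr_ae ?_
    filter_upwards [hσ.coeFn_toLp] with t ht
    rw [ht, hσ_mul]

/-- The product of the class `f` with the indicator function of `A`, again as an element of `Lp`. -/
noncomputable def indicatorLp {p : ℝ≥0∞} {A : Set α} (hA : MeasurableSet A) (f : Lp E p μ) :
    Lp E p μ :=
  ((Lp.memLp f).indicator hA).toLp

variable {p : ℝ≥0∞} {A B : Set α}

theorem coeFn_indicatorLp (hA : MeasurableSet A) (f : Lp E p μ) :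
    indicatorLp hA f =ᵐ[μ] A.indicator f :=
  ((Lp.memLp f).indicator hA).coeFn_toLp

theorem indicatorLp_sub_of_subset (hA : MeasurableSet A) (hB : MeasurableSet B) (hAB : A ⊆ B)
    (f : Lp E p μ) : indicatorLp hB f - indicatorLp hA f = indicatorLp (hB.diff hA) f := by
  refine Lp.ext ?_
  filter_upwards [Lp.coeFn_sub (indicatorLp hB f) (indicatorLp hA f), coeFn_indicatorLp hA f,
    coeFn_indicatorLp hB f, coeFn_indicatorLp (hB.diff hA) f] with t hsub hA hB hdiff
  rw [hsub, Pi.sub_apply, hA, hB, hdiff, Set.indicator_sdiff hAB, Pi.sub_apply]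

theorem indicatorLp_eq_zero (hA : MeasurableSet A) (hμA : μ A = 0) (f : Lp E p μ) :
    indicatorLp hA f = 0 := by
  refine Lp.ext ?_
  filter_upwards [coeFn_indicatorLp hA f, measure_eq_zero_iff_ae_notMem.1 hμA,
    Lp.coeFn_zero E p μ] with t ht htA h0
  rw [ht, Set.indicator_of_notMem htA, h0, Pi.zero_apply]

theorem indicatorLp_eq_self (hA : MeasurableSet A) (hμA : ∀ᵐ t ∂μ, t ∈ A) (f : Lp E p μ) :
    indicatorLp hA f = f := by
  refine Lp.ext ?_
  filter_upwards [coeFn_indicatorLp hA f, hμA] with t ht htA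
  rw [ht, Set.indicator_of_mem htA]

theorem norm_indicatorLp_one (hA : MeasurableSet A) (f : Lp E 1 μ) :
    ‖indicatorLp hA f‖ = ∫ t in A, ‖f t‖ ∂μ := by
  rw [L1.norm_eq_integral_norm, ← integral_indicator hA]
  refine integral_congr_ae ?_
  filter_upwards [coeFn_indicatorLp hA f] with t ht
  rw [ht, norm_indicator_eq_indicator_norm]

theorem integral_mul_indicatorLp {q : ℝ≥0∞} (hA : MeasurableSet A) (x : Lp ℝ q μ) (f : Lp ℝ p μ) :
    ∫ t, x t * indicatorLp hA f t ∂μ = ∫ t in A, x t * f t ∂μ := by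
  rw [← integral_indicator hA]
  refine integral_congr_ae ?_
  filter_upwards [coeFn_indicatorLp hA f] with t ht
  rw [ht, Set.indicator_mul_right]

theorem hasSum_setIntegral [NormedSpace ℝ E] [CompleteSpace E] {ι : Type*} {F : ι → Lp E 1 μ}
    {G : Lp E 1 μ} (h : HasSum F G) (A : Set α) :
    HasSum (fun i => ∫ t in A, F i t ∂μ) (∫ t in A, G t ∂μ) := by
  have hintegral (f : Lp E 1 μ) : (L1.integralCLM.comp (LpToLpRestrictCLM α E ℝ μ 1 A)) f =
      ∫ t in A, f t ∂μ := by
    rw [← integral_congr_ae (LpToLpRestrictCLM_coeFn ℝ A f), ← L1.integral_eq_integral,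
      L1.integral_eq]
    rfl
  simpa only [hintegral] using (L1.integralCLM.comp (LpToLpRestrictCLM α E ℝ μ 1 A)).hasSum h

theorem exists_integrable_hasSum_setIntegral_smul [NormedSpace ℝ E] [CompleteSpace E] {ι : Type*}
    {x : ι → Lp ℝ ∞ μ} {e : ι → E} (hs : Summable fun i => ‖e i‖ * ‖x i‖) (f : Lp ℝ 1 μ) :
    ∃ H : α → E, Integrable H μ ∧
      ∀ A, HasSum (fun i => (∫ t in A, x i t * f t ∂μ) • e i) (∫ t in A, H t ∂μ) := by
  let F : ι → Lp E 1 μ := fun i =>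
    (ContinuousLinearMap.toSpanSingleton ℝ (e i)).compLp (x i • f : Lp ℝ 1 μ)
  have hF_norm : ∀ i, ‖F i‖ ≤ ‖e i‖ * ‖x i‖ * ‖f‖ := fun i =>
    calc ‖F i‖ ≤ ‖ContinuousLinearMap.toSpanSingleton ℝ (e i)‖ * ‖(x i • f : Lp ℝ 1 μ)‖ :=
          ContinuousLinearMap.norm_compLp_le _ _
      _ ≤ ‖e i‖ * (‖x i‖ * ‖f‖) := by
          rw [ContinuousLinearMap.norm_toSpanSingleton]
          gcongr
          exact Lp.norm_smul_le _ _
      _ = ‖e i‖ * ‖x i‖ * ‖f‖ := (mul_assoc _ _ _).symm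
  have hF : Summable F := .of_norm_bounded (hs.mul_right ‖f‖) hF_norm
  have hF_ae : ∀ i, ∀ᵐ t ∂μ, F i t = (x i t * f t) • e i := fun i => by
    filter_upwards [ContinuousLinearMap.coeFn_compLp (ContinuousLinearMap.toSpanSingleton ℝ (e i))
      (x i • f : Lp ℝ 1 μ), Lp.coeFn_lpSMul (r := 1) (x i) f] with t hcomp hsmul
    rw [hcomp, ContinuousLinearMap.toSpanSingleton_apply, hsmul, Pi.smul_apply', smul_eq_mul]
  refine ⟨⇑(∑' i, F i), L1.integrable_coeFn _, fun A => ?_⟩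
  convert hasSum_setIntegral hF.hasSum A using 2 with i
  rw [integral_congr_ae (ae_restrict_of_ae (hF_ae i)), integral_smul_const]

end Lp

/-! ### Independent uniform variables -/

instance : IsProbabilityMeasure lebesgue01 := ⟨by simp⟩

theorem real_lebesgue01_Ioc {s t : ℝ} (hs : 0 ≤ s) (hst : s ≤ t) (ht : t ≤ 1) :
    lebesgue01.real (Ioc s t) = t - s := by
  rw [measureReal_restrict_apply measurableSet_Ioc, inter_eq_self_of_subset_left
    (Ioc_subset_Icc_self.trans (Icc_subset_Icc hs ht)), Real.volume_real_Ioc_of_le hst]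

theorem real_lebesgue01_Iic (s : ℝ) : lebesgue01.real (Iic s) = max 0 (min 1 s) := by
  rw [measureReal_restrict_apply measurableSet_Iic, inter_comm, ← Ici_inter_Iic, inter_assoc,
    Iic_inter_Iic, Ici_inter_Iic, Real.volume_real_Icc, sub_zero, max_comm]

theorem continuous_cdf (μ : Measure ℝ) [IsProbabilityMeasure μ] [NullSingletonClass μ] :
    Continuous (cdf μ) := by
  refine continuous_iff_continuousAt.2 fun a => ?_
  rw [(monotone_cdf μ).continuousAt_iff_leftLim_eq_rightLim, StieltjesFunction.rightLim_eq]
  have h : ENNReal.ofReal (cdf μ a - Function.leftLim (cdf μ) a) = 0 := by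
    rw [← StieltjesFunction.measure_singleton, measure_cdf, measure_singleton]
  rw [ENNReal.ofReal_eq_zero] at h
  exact le_antisymm ((monotone_cdf μ).leftLim_le le_rfl) (sub_nonpos.1 h)

theorem measureReal_cdf_le (μ : Measure ℝ) [IsProbabilityMeasure μ] [NullSingletonClass μ] {s : ℝ}
    (hs0 : 0 ≤ s) (hs1 : s < 1) : μ.real {r | cdf μ r ≤ s} = s := by
  have hcont := continuous_cdf μ
  set S : Set ℝ := {r | cdf μ r ≤ s}
  rcases S.eq_empty_or_nonempty with hS | hS
  · have hs : s ≤ 0 := ge_of_tendsto (tendsto_cdf_atBot μ)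
      (.of_forall fun r => (not_le.1 (eq_empty_iff_forall_notMem.1 hS r)).le)
    rw [hS, measureReal_empty, le_antisymm hs hs0]
  obtain ⟨b, hb⟩ := ((tendsto_cdf_atTop μ).eventually_const_lt hs1).exists
  have hbdd : BddAbove S :=
    ⟨b, fun r hr => (le_of_not_ge fun h => (hb.trans_le (monotone_cdf μ h)).not_ge hr)⟩
  have hmax : sSup S ∈ S := (isClosed_le hcont continuous_const).csSup_mem hS hbdd
  have hS_eq : S = Iic (sSup S) :=
    Subset.antisymm (fun r hr => le_csSup hbdd hr) fun r hr => (monotone_cdf μ hr).trans hmax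
  have hcdf : cdf μ (sSup S) = s := by
    have hlim := (hcont.tendsto (sSup S)).mono_left (nhdsWithin_le_nhds (s := Ioi (sSup S)))
    refine le_antisymm hmax (ge_of_tendsto hlim ?_)
    filter_upwards [self_mem_nhdsWithin] with r hr
    exact (not_le.1 fun h => (le_csSup hbdd h).not_gt hr).le
  rw [hS_eq, ← cdf_eq_real, hcdf]

theorem measurePreserving_cdf (μ : Measure ℝ) [IsProbabilityMeasure μ] [NullSingletonClass μ] :
    MeasurePreserving (cdf μ) μ lebesgue01 := by
  have hmeas : Measurable (cdf μ) := (monotone_cdf μ).measurable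
  have := Measure.isProbabilityMeasure_map (μ := μ) hmeas.aemeasurable
  refine ⟨hmeas, Measure.eq_of_cdf _ _ (StieltjesFunction.ext fun s => ?_)⟩
  rw [cdf_eq_real, cdf_eq_real, map_measureReal_apply hmeas measurableSet_Iic, real_lebesgue01_Iic]
  change μ.real {r | cdf μ r ≤ s} = _
  rcases lt_or_ge s 0 with hs0 | hs0
  · have hempty : {r | cdf μ r ≤ s} = ∅ := eq_empty_of_forall_notMem fun r hr =>
      (hs0.trans_le (cdf_nonneg μ r)).not_ge hr
    rw [hempty, measureReal_empty, max_eq_left ((min_le_right _ _).trans hs0.le)]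
  rcases lt_or_ge s 1 with hs1 | hs1
  · rw [measureReal_cdf_le μ hs0 hs1, min_eq_right hs1.le, max_eq_right hs0]
  · have huniv : {r | cdf μ r ≤ s} = univ := eq_univ_of_forall fun r => (cdf_le_one μ r).trans hs1
    rw [huniv, probReal_univ, min_eq_left hs1, max_eq_right zero_le_one]

/-- The distribution function of `μ` conditioned on the fiber of `J` through `r`, evaluated at `r`:
the distribution functions of the conditional measures on the fibers, glued to a single function.
It is a uniform variable independent of `J`. -/
noncomputable def fiberCDF (μ : Measure ℝ) {β : Type*} (J : ℝ → β) (r : ℝ) : ℝ :=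
  cdf μ[|J ⁻¹' {J r}] r

section FiberCDF

variable {μ : Measure ℝ} {β : Type*} [MeasurableSpace β] [Countable β]
  [MeasurableSingletonClass β] {J : ℝ → β}

theorem measurable_fiberCDF (hJ : Measurable J) : Measurable (fiberCDF μ J) := by
  have h (F : β → StieltjesFunction ℝ) : Measurable fun r => F (J r) r :=
    (measurable_from_prod_countable_left fun j => (F j).mono.measurable :
      Measurable fun q : ℝ × β => F q.2 q.1).comp (measurable_id.prodMk hJ)
  exact h fun j => cdf μ[|J ⁻¹' {j}]

variable [IsProbabilityMeasure μ] [NullSingletonClass μ]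

theorem measure_fiber_inter_fiberCDF_preimage (hJ : Measurable J) (j : β) {B : Set ℝ}
    (hB : MeasurableSet B) :
    μ (J ⁻¹' {j} ∩ fiberCDF μ J ⁻¹' B) = lebesgue01 B * μ (J ⁻¹' {j}) := by
  have hE : MeasurableSet (J ⁻¹' {j}) := hJ (measurableSet_singleton j)
  rcases eq_or_ne (μ (J ⁻¹' {j})) 0 with h0 | h0
  · rw [h0, mul_zero, measure_mono_null inter_subset_left h0]
  have : IsProbabilityMeasure μ[|J ⁻¹' {j}] := cond_isProbabilityMeasure h0
  have : NullSingletonClass μ[|J ⁻¹' {j}] :=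
    ⟨fun r => cond_absolutelyContinuous (measure_singleton r)⟩
  have heq : fiberCDF μ J =ᵐ[μ[|J ⁻¹' {j}]] cdf μ[|J ⁻¹' {j}] := by
    filter_upwards [ae_cond_mem hE] with r hr
    rw [fiberCDF, hr]
  rw [← cond_mul_eq_inter hE, ← Measure.map_apply (measurable_fiberCDF hJ) hB,
    Measure.map_congr heq, (measurePreserving_cdf _).map_eq]

theorem map_restrict_fiberCDF_preimage (hJ : Measurable J) {B : Set ℝ} (hB : MeasurableSet B) :
    (μ.restrict (fiberCDF μ J ⁻¹' B)).map J = lebesgue01 B • μ.map J := by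
  refine Measure.ext_of_singleton fun j => ?_
  have hj : MeasurableSet {j} := measurableSet_singleton j
  rw [Measure.map_apply hJ hj, Measure.restrict_apply (hJ hj), Measure.smul_apply,
    Measure.map_apply hJ hj, smul_eq_mul, measure_fiber_inter_fiberCDF_preimage hJ j hB]

theorem measurePreserving_fiberCDF (hJ : Measurable J) :
    MeasurePreserving (fiberCDF μ J) μ lebesgue01 := by
  refine ⟨measurable_fiberCDF hJ, Measure.ext fun B hB => ?_⟩
  have h := congrArg (· univ) (map_restrict_fiberCDF_preimage (μ := μ) hJ hB)
  simpa [Measure.map_apply hJ, Measure.map_apply (measurable_fiberCDF hJ) hB] using h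

theorem indepFun_fiberCDF (hJ : Measurable J) : IndepFun J (fiberCDF μ J) μ := by
  refine indepFun_iff_measure_inter_preimage_eq_mul.2 fun S B hS hB => ?_
  have h := congrArg (· S) (map_restrict_fiberCDF_preimage (μ := μ) hJ hB)
  rw [(measurePreserving_fiberCDF hJ).measure_preimage hB.nullMeasurableSet, mul_comm]
  simpa [Measure.map_apply hJ hS, Measure.restrict_apply (hJ hS)] using h

end FiberCDF

theorem setIntegral_preimage_of_indepFun {Ω β γ E : Type*} [MeasurableSpace Ω]
    [MeasurableSpace β] [MeasurableSpace γ] [NormedAddCommGroup E] [NormedSpace ℝ E]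
    [CompleteSpace E] {μ : Measure Ω} [IsProbabilityMeasure μ] {J : Ω → β} {Φ : Ω → γ}
    {q : β → E} (hJ : Measurable J) (hΦ : Measurable Φ) (hind : IndepFun J Φ μ)
    (hq : StronglyMeasurable q) (hint : Integrable (fun ω => q (J ω)) μ) {B : Set γ}
    (hB : MeasurableSet B) :
    ∫ ω in Φ ⁻¹' B, q (J ω) ∂μ = μ.real (Φ ⁻¹' B) • ∫ ω, q (J ω) ∂μ := by
  have hB' : MeasurableSet[MeasurableSpace.comap Φ ‹_›] (Φ ⁻¹' B) := ⟨B, hB, rfl⟩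
  have hcond := condExp_indep_eq (f := fun ω => q (J ω)) hJ.comap_le hΦ.comap_le
    (hq.comp_measurable (comap_measurable J)) hind
  have h := setIntegral_condExp hΦ.comap_le hint hB'
  rw [setIntegral_congr_ae (hΦ hB) (hcond.mono fun _ h _ => h), setIntegral_const] at h
  exact h.symm

theorem exists_measurable_nat_dist_lt {α E : Type*} [MeasurableSpace α] [PseudoMetricSpace E]
    [Nonempty E] {p : α → E} (hp : StronglyMeasurable p) {ε : ℝ} (hε : 0 < ε) :
    ∃ (J : α → ℕ) (c : ℕ → E), Measurable J ∧ ∀ a, dist (p a) (c (J a)) < ε := by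
  classical
  obtain ⟨S, hS, hpS⟩ := hp.isSeparable_range
  rcases S.eq_empty_or_nonempty with rfl | hne
  · have : IsEmpty α := ⟨fun a => by simpa using hpS (mem_range_self a)⟩
    exact ⟨isEmptyElim, fun _ => Classical.arbitrary E, measurable_of_empty _, isEmptyElim⟩
  obtain ⟨c, rfl⟩ := hS.exists_eq_range hne
  have hex : ∀ a, ∃ n, dist (p a) (c n) < ε := fun a => by
    obtain ⟨_, ⟨n, rfl⟩, hn⟩ := Metric.mem_closure_iff.1 (hpS (mem_range_self a)) ε hε
    exact ⟨n, hn⟩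
  exact ⟨fun a => Nat.find (hex a), c,
    measurable_find hex fun n => (hp.dist stronglyMeasurable_const).measurable measurableSet_Iio,
    fun a => Nat.find_spec (hex a)⟩

theorem exists_measurePreserving_norm_setIntegral_sub_le {E : Type*} [NormedAddCommGroup E]
    [NormedSpace ℝ E] [CompleteSpace E] {μ : Measure ℝ} [IsProbabilityMeasure μ]
    [NullSingletonClass μ] {p : ℝ → E} (hp : Integrable p μ) {ε : ℝ} (hε : 0 < ε) :
    ∃ Φ : ℝ → ℝ, MeasurePreserving Φ μ lebesgue01 ∧ ∀ B, MeasurableSet B →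
      ‖∫ r in Φ ⁻¹' B, p r ∂μ - lebesgue01.real B • ∫ r, p r ∂μ‖ ≤ ε * lebesgue01.real B := by
  obtain ⟨J, c, hJ, hdist⟩ :=
    exists_measurable_nat_dist_lt hp.1.stronglyMeasurable_mk (half_pos hε)
  have herr : ∀ᵐ r ∂μ, ‖p r - c (J r)‖ ≤ ε / 2 := by
    filter_upwards [hp.1.ae_eq_mk] with r hr
    rw [hr, ← dist_eq_norm]
    exact (hdist r).le
  have hc : StronglyMeasurable c := .of_discrete
  have herr_int : Integrable (fun r => p r - c (J r)) μ :=
    .of_bound (hp.1.sub (hc.comp_measurable hJ).aestronglyMeasurable) (ε / 2) herr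
  have hc_int : Integrable (fun r => c (J r)) μ :=
    (hp.sub herr_int).congr (.of_forall fun r => sub_sub_cancel _ _)
  have hΦ := measurePreserving_fiberCDF (μ := μ) hJ
  refine ⟨fiberCDF μ J, hΦ, fun B hB => ?_⟩
  set D := fiberCDF μ J ⁻¹' B
  have hD : μ.real D = lebesgue01.real B := hΦ.measureReal_preimage hB.nullMeasurableSet
  have hsplit : ∫ r in D, p r ∂μ - μ.real D • ∫ r, p r ∂μ =
      ∫ r in D, (p r - c (J r)) ∂μ - μ.real D • ∫ r, (p r - c (J r)) ∂μ := by
    rw [integral_sub hp.integrableOn hc_int.integrableOn, integral_sub hp hc_int,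
      setIntegral_preimage_of_indepFun hJ hΦ.measurable (indepFun_fiberCDF hJ) hc hc_int hB,
      smul_sub, sub_sub_sub_cancel_right]
  have hlocal : ‖∫ r in D, (p r - c (J r)) ∂μ‖ ≤ ε / 2 * μ.real D :=
    norm_setIntegral_le_of_norm_le_const_ae (measure_lt_top _ _) (ae_restrict_of_ae herr)
  have hglobal : ‖∫ r, (p r - c (J r)) ∂μ‖ ≤ ε / 2 := by
    simpa using norm_integral_le_of_norm_le_const herr
  rw [← hD, hsplit]
  calc _ ≤ ‖∫ r in D, (p r - c (J r)) ∂μ‖ + ‖μ.real D • ∫ r, (p r - c (J r)) ∂μ‖ := norm_sub_le _ _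
    _ ≤ ε / 2 * μ.real D + μ.real D * (ε / 2) := by
        rw [norm_smul, Real.norm_of_nonneg measureReal_nonneg]
        gcongr
    _ = ε * μ.real D := by ring

/-! ### The renormed space and its unimodular functions -/

theorem unimodular_eq_preimage :
    unimodular = (fun f : L1 => |f|) ⁻¹' {Lp.const 1 lebesgue01 (1 : ℝ)} := by
  ext f
  have habs := Lp.coeFn_abs f
  have hone := Lp.coeFn_const 1 lebesgue01 (1 : ℝ)
  constructor
  · intro h
    refine Lp.ext ?_
    filter_upwards [h, habs, hone] with t h habs hone
    rw [habs, hone, h, Function.const_apply]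
  · intro h
    rw [Set.mem_preimage, Set.mem_singleton_iff] at h
    rw [h] at habs
    filter_upwards [habs, hone] with t habs hone
    rw [← habs, hone, Function.const_apply]

theorem isClosed_unimodular : IsClosed unimodular := by
  rw [unimodular_eq_preimage]
  exact isClosed_singleton.preimage (by simp only [abs]; fun_prop)

theorem const_mem_unimodular {c : ℝ} (hc : |c| = 1) : Lp.const 1 lebesgue01 c ∈ unimodular := by
  filter_upwards [Lp.coeFn_const 1 lebesgue01 c] with t ht
  rw [ht, Function.const_apply, hc]

theorem zero_notMem_unimodular : (0 : L1) ∉ unimodular := by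
  intro (h : ∀ᵐ t ∂lebesgue01, |(0 : L1) t| = 1)
  obtain ⟨t, ht, ht0⟩ := (h.and (Lp.coeFn_zero ℝ 1 lebesgue01)).exists
  rw [ht0, Pi.zero_apply, abs_zero] at ht
  exact zero_ne_one ht

theorem convexCombination_notMem_unimodular {f g : L1} (hf : f ∈ unimodular) (hg : g ∈ unimodular)
    (hfg : f ≠ g) {s : ℝ} (hs0 : 0 < s) (hs1 : s < 1) : s • f + (1 - s) • g ∉ unimodular := by
  intro h
  refine hfg (Lp.ext ?_)
  filter_upwards [hf, hg, h, Lp.coeFn_add (s • f) ((1 - s) • g), Lp.coeFn_smul s f,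
    Lp.coeFn_smul (1 - s) g] with t hf hg h hadd hsf hsg
  rw [hadd, Pi.add_apply, hsf, hsg, Pi.smul_apply, Pi.smul_apply, smul_eq_mul, smul_eq_mul] at h
  rcases eq_or_eq_neg_of_abs_eq hf with hf | hf <;>
    rcases eq_or_eq_neg_of_abs_eq hg with hg | hg <;>
    rcases eq_or_eq_neg_of_abs_eq h with h | h <;> rw [hf, hg] at h ⊢ <;> linarith

theorem add_indicatorLp_sub_mem_unimodular {f g : L1} (hf : f ∈ unimodular) (hg : g ∈ unimodular)
    {A : Set ℝ} (hA : MeasurableSet A) : f + indicatorLp hA (g - f) ∈ unimodular := by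
  filter_upwards [hf, hg, Lp.coeFn_add f (indicatorLp hA (g - f)), coeFn_indicatorLp hA (g - f),
    Lp.coeFn_sub g f] with t hf hg hadd hind hsub
  rw [hadd, Pi.add_apply, hind]
  by_cases ht : t ∈ A
  · rw [Set.indicator_of_mem ht, hsub, Pi.sub_apply, add_sub_cancel, hg]
  · rw [Set.indicator_of_notMem ht, add_zero, hf]

theorem abs_pairing_le {x : LInf} (hx : ‖x‖ = 1) (f : L1) : |pairing x f| ≤ ‖f‖ :=
  (norm_integral_mul_le x f).trans_eq (by rw [hx, one_mul])

theorem nonempty_totalSeq : Nonempty TotalSeq := by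
  have : Fact ((1 : ℝ≥0∞) ≠ ∞) := ⟨ENNReal.one_ne_top⟩
  choose x hx_norm hx_norming using fun f : L1 => exists_norm_eq_one_integral_mul_eq_norm f
  let d := TopologicalSpace.denseSeq L1
  refine ⟨⟨fun n => x (d n), fun n => hx_norm _, fun f hf => ?_⟩⟩
  refine eq_zero_of_denseRange_of_norming (TopologicalSpace.denseRange_denseSeq L1)
    (φ := fun n => (ContinuousLinearMap.mul ℝ ℝ).lpPairing lebesgue01 ∞ 1 (x (d n)))
    (fun n v => ?_) (fun n => ?_) (fun n => ?_) <;> rw [← pairing_eq]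
  · exact abs_pairing_le (hx_norm _) v
  · exact hx_norming (d n)
  · exact hf n

variable (x : TotalSeq)

/-- The operator `f ↦ (2^{-n/2} xₙ*(f))ₙ` from `L₁[0,1]` to `ℓ₂`, whose norm is the second summand
of `renorm`. The coordinates are indexed from `0`, so the weight of the `n`-th one is
`2^{-(n+1)/2}`. -/
noncomputable def toL2 : L1 →ₗ[ℝ] lp (fun _ : ℕ => ℝ) 2 where
  toFun f := ⟨fun n => √((1 / 2) ^ (n + 1)) * pairing (x.seq n) f, by
    refine memℓp_gen ?_
    convert summable_renorm x f using 2 with n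
    rw [ENNReal.toReal_ofNat, Real.rpow_two, Real.norm_eq_abs, sq_abs, mul_pow, sq_abs,
      Real.sq_sqrt (by positivity)]⟩
  map_add' f g := Subtype.ext <| funext fun n =>
    (congrArg (_ * ·) (pairing_add (x.seq n) f g)).trans (mul_add _ _ _)
  map_smul' c f := Subtype.ext <| funext fun n =>
    (congrArg (_ * ·) (pairing_smul (x.seq n) c f)).trans (mul_left_comm _ _ _)

theorem toL2_apply (f : L1) (n : ℕ) :
    toL2 x f n = √((1 / 2) ^ (n + 1)) * pairing (x.seq n) f := rfl

theorem norm_toL2 (f : L1) :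
    ‖toL2 x f‖ = √(∑' n : ℕ, (1 / 2 : ℝ) ^ (n + 1) * |pairing (x.seq n) f| ^ 2) := by
  rw [lp.norm_eq_tsum_rpow (by simp), Real.sqrt_eq_rpow, ENNReal.toReal_ofNat]
  congr 2
  ext n
  rw [toL2_apply, Real.rpow_two, Real.norm_eq_abs, sq_abs, mul_pow, sq_abs,
    Real.sq_sqrt (by positivity)]

theorem renorm_eq (f : L1) : renorm x f = ‖f‖ + ‖toL2 x f‖ := by
  rw [renorm, norm_toL2]

theorem toL2_injective : Function.Injective (toL2 x) := by
  refine (injective_iff_map_eq_zero _).2 fun f hf => x.total f fun n => ?_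
  have h : toL2 x f n = 0 := by rw [hf]; rfl
  rw [toL2_apply] at h
  exact (mul_eq_zero.1 h).resolve_left (by positivity)

theorem norm_toL2_le (f : L1) : ‖toL2 x f‖ ≤ ‖f‖ := by
  have hgeom : HasSum (fun n : ℕ => (1 / 2 : ℝ) ^ (n + 1) * ‖f‖ ^ 2) (‖f‖ ^ 2) := by
    simpa [pow_succ] using (hasSum_geometric_two.mul_right (1 / 2 : ℝ)).mul_right (‖f‖ * ‖f‖)
  rw [norm_toL2, ← Real.sqrt_sq (norm_nonneg f), ← hgeom.tsum_eq]
  refine Real.sqrt_le_sqrt ((summable_renorm x f).tsum_le_tsum (fun n => ?_) hgeom.summable)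
  gcongr
  exact abs_pairing_le (x.norm_seq n) f

theorem norm_toL1_le (f : RenormedL1 x) : ‖RenormedL1.toL1 x f‖ ≤ ‖f‖ :=
  norm_le_renorm x _

theorem norm_le_two_mul_norm_toL1 (f : RenormedL1 x) : ‖f‖ ≤ 2 * ‖RenormedL1.toL1 x f‖ := by
  rw [two_mul]
  exact (renorm_eq x _).trans_le (add_le_add_right (norm_toL2_le x _) _)

instance strictConvexSpace_renormedL1 : StrictConvexSpace ℝ (RenormedL1 x) :=
  strictConvexSpace_of_norm_eq_add (RenormedL1.toL1 x).toLinearMap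
    (T := toL2 x ∘ₗ (RenormedL1.toL1 x).toLinearMap)
    ((toL2_injective x).comp (RenormedL1.toL1 x).injective) fun _ => renorm_eq x _

/-- The identity map as an isomorphism between the renormed space and `L₁[0,1]`. -/
noncomputable def toL1Equiv : RenormedL1 x ≃L[ℝ] L1 :=
  (RenormedL1.toL1 x).toContinuousLinearEquivOfBounds 1 2
    (fun f => (norm_toL1_le x f).trans_eq (one_mul _).symm) fun f => norm_le_two_mul_norm_toL1 x f

theorem completeSpace_M : CompleteSpace (M x) := by
  have : CompleteSpace (RenormedL1 x) :=
    (completeSpace_congr (e := (toL1Equiv x).toEquiv) (toL1Equiv x).isUniformEmbedding).2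
      inferInstance
  exact (isClosed_unimodular.preimage (toL1Equiv x).continuous).completeSpace_coe

theorem not_metricallyConvex_M : ¬ MetricallyConvex (M x) := by
  intro h
  have hmid := MetricallyConvex.midpoint_mem (S := {f | RenormedL1.toL1 x f ∈ unimodular}) h
    (a := (RenormedL1.toL1 x).symm (Lp.const 1 lebesgue01 1))
    (b := (RenormedL1.toL1 x).symm (Lp.const 1 lebesgue01 (-1)))
    (const_mem_unimodular (by simp)) (const_mem_unimodular (by simp))
  rw [midpoint_eq_smul_add, ← map_add, ← map_add, add_neg_cancel, map_zero, map_zero, smul_zero,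
    Set.mem_ofPred_eq, map_zero] at hmid
  exact zero_notMem_unimodular hmid

theorem summable_sqrt_geometric {r : ℝ} (hr0 : 0 ≤ r) (hr1 : r < 1) :
    Summable fun n : ℕ => √(r ^ n) := by
  have hpow : ∀ n : ℕ, √(r ^ n) = √r ^ n := fun n =>
    (Real.sqrt_eq_iff_mul_self_eq (by positivity) (by positivity)).2
      (by rw [← mul_pow, Real.mul_self_sqrt hr0])
  simp only [hpow]
  exact summable_geometric_of_lt_one (Real.sqrt_nonneg r) ((Real.sqrt_lt' one_pos).2 (by simpa))

theorem exists_integrable_toL2_indicatorLp (f : L1) :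
    ∃ H : ℝ → lp (fun _ : ℕ => ℝ) 2, Integrable H lebesgue01 ∧
      ∀ ⦃A : Set ℝ⦄ (hA : MeasurableSet A),
        toL2 x (indicatorLp hA f) = ∫ t in A, H t ∂lebesgue01 := by
  have hsummable : Summable fun n : ℕ =>
      ‖(lp.single 2 n √((1 / 2) ^ (n + 1)) : lp (fun _ : ℕ => ℝ) 2)‖ * ‖x.seq n‖ := by
    simp only [lp.norm_single zero_lt_two, x.norm_seq, mul_one, Real.norm_of_nonneg,
      Real.sqrt_nonneg]
    exact (summable_nat_add_iff 1).2 (summable_sqrt_geometric one_half_pos.le one_half_lt_one)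
  obtain ⟨H, hH, hsum⟩ := exists_integrable_hasSum_setIntegral_smul hsummable f
  refine ⟨H, hH, fun A hA =>
    (lp.hasSum_single ENNReal.ofNat_ne_top (toL2 x (indicatorLp hA f))).unique ?_⟩
  convert hsum A using 2 with n
  rw [toL2_apply, pairing, integral_mul_indicatorLp, ← lp.single_smul, smul_eq_mul, mul_comm]

theorem exists_measurePreserving_renorm_indicatorLp_le (h : L1) {η : ℝ} (hη : 0 < η) :
    ∃ (Φ : ℝ → ℝ) (hΦ : MeasurePreserving Φ lebesgue01 lebesgue01), ∀ ⦃B⦄ (hB : MeasurableSet B),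
      renorm x (indicatorLp (hΦ.measurable hB) h) ≤ lebesgue01.real B * (renorm x h + η) := by
  obtain ⟨H, hH, hHA⟩ := exists_integrable_toL2_indicatorLp x h
  have hh : Integrable (fun t => ‖h t‖) lebesgue01 := (L1.integrable_coeFn h).norm
  have hHh : toL2 x h = ∫ t, H t ∂lebesgue01 := by
    rw [← setIntegral_univ, ← hHA .univ, indicatorLp_eq_self _ (by simp)]
  obtain ⟨Φ, hΦ, hΦB⟩ :=
    exists_measurePreserving_norm_setIntegral_sub_le (hh.prodMk hH) (half_pos hη)
  refine ⟨Φ, hΦ, fun B hB => ?_⟩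
  set b := lebesgue01.real B
  have hb : 0 ≤ b := measureReal_nonneg
  specialize hΦB B hB
  rw [integral_pair hh.integrableOn hH.integrableOn, integral_pair hh hH, ← hHA (hΦ.measurable hB),
    ← hHh, ← norm_indicatorLp_one (hΦ.measurable hB), ← L1.norm_eq_integral_norm] at hΦB
  set d := indicatorLp (hΦ.measurable hB) h
  have hnorm : ‖d‖ ≤ b * ‖h‖ + η / 2 * b := by
    exact sub_le_iff_le_add'.1 ((Real.le_norm_self _).trans ((norm_fst_le _).trans hΦB))
  have htoL2 : ‖toL2 x d‖ ≤ b * ‖toL2 x h‖ + η / 2 * b := by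
    calc ‖toL2 x d‖ ≤ ‖b • toL2 x h‖ + ‖toL2 x d - b • toL2 x h‖ :=
          norm_le_norm_add_norm_sub' _ _
      _ ≤ b * ‖toL2 x h‖ + η / 2 * b := by
          rw [norm_smul, Real.norm_of_nonneg hb]
          exact add_le_add_right ((norm_snd_le _).trans hΦB) _
  rw [renorm_eq, renorm_eq]
  linarith

theorem almostMetricallyConvex_M : AlmostMetricallyConvex (M x) := by
  refine .of_unitInterval fun f g η hη => ?_
  let e := RenormedL1.toL1 x
  obtain ⟨Φ, hΦ, hspeed⟩ := exists_measurePreserving_renorm_indicatorLp_le x (e g - e f) hη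
  have hA : ∀ s, MeasurableSet (Φ ⁻¹' Iic s) := fun s => hΦ.measurable measurableSet_Iic
  have hdist : renorm x (e g - e f) = dist f g := by
    rw [dist_comm]
    exact (dist_eq_norm (g : RenormedL1 x) f).symm
  refine ⟨fun s => ⟨e.symm (e f + indicatorLp (hA s) (e g - e f)),
    add_indicatorLp_sub_mem_unimodular f.2 g.2 (hA s)⟩, ?_, ?_, fun s u hs hsu hu => ?_⟩
  · have hnull : lebesgue01 (Φ ⁻¹' Iic 0) = 0 := by
      rw [hΦ.measure_preimage measurableSet_Iic.nullMeasurableSet, ← measureReal_eq_zero_iff,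
        real_lebesgue01_Iic]
      simp
    refine Subtype.ext (e.symm_apply_eq.2 ?_)
    rw [indicatorLp_eq_zero _ hnull, add_zero]
  · have hfull : ∀ᵐ t ∂lebesgue01, t ∈ Φ ⁻¹' Iic 1 := hΦ.quasiMeasurePreserving.ae
      ((ae_restrict_mem measurableSet_Icc).mono fun _ ht => ht.2)
    refine Subtype.ext (e.symm_apply_eq.2 ?_)
    rw [indicatorLp_eq_self _ hfull, add_sub_cancel]
  · have hlength : lebesgue01.real (Iic u \ Iic s) = u - s := by
      rw [Iic_sdiff_Iic, real_lebesgue01_Ioc hs hsu hu]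
    have h := hspeed ((measurableSet_Iic (a := u)).diff (measurableSet_Iic (a := s)))
    rw [hlength, hdist] at h
    refine le_trans (le_of_eq ?_) h
    rw [dist_comm]
    refine (dist_eq_norm (E := RenormedL1 x) _ _).trans ?_
    change renorm x (e f + _ - (e f + _)) = _
    rw [add_sub_add_left_eq_sub, indicatorLp_sub_of_subset (hA s) (hA u)
      (preimage_mono (Iic_subset_Iic.2 hsu))]
    rfl

end LipDaugavet

theorem mainTheorem10 :
    -- `M = {f : |f| = 1 a.e.}` is closed in `L₁[0,1]`
    IsClosed LipDaugavet.unimodular ∧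
    -- no nontrivial convex combination of two distinct elements of `M` belongs to `M`
    (∀ f ∈ LipDaugavet.unimodular, ∀ g ∈ LipDaugavet.unimodular, f ≠ g →
      ∀ s : ℝ, 0 < s → s < 1 → s • f + (1 - s) • g ∉ LipDaugavet.unimodular) ∧
    -- total sequences exist in the unit sphere of `L_∞[0,1]`, and for each of them:
    Nonempty LipDaugavet.TotalSeq ∧
    ∀ x : LipDaugavet.TotalSeq,
      -- the new norm is equivalent to the `L₁`-norm
      (∃ c C : ℝ, 0 < c ∧ 0 < C ∧ ∀ f : LipDaugavet.RenormedL1 x,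
        c * ‖LipDaugavet.RenormedL1.toL1 x f‖ ≤ ‖f‖ ∧
        ‖f‖ ≤ C * ‖LipDaugavet.RenormedL1.toL1 x f‖) ∧
      -- and strictly convex
      StrictConvexSpace ℝ (LipDaugavet.RenormedL1 x) ∧
      -- and `M` with the induced metric is complete, noncompact, almost metrically convex, and
      -- not metrically convex
      CompleteSpace (LipDaugavet.M x) ∧
      ¬ CompactSpace (LipDaugavet.M x) ∧
      AlmostMetricallyConvex (LipDaugavet.M x) ∧
      ¬ MetricallyConvex (LipDaugavet.M x) := by
  refine ⟨LipDaugavet.isClosed_unimodular, fun f hf g hg hfg s hs0 hs1 =>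
    LipDaugavet.convexCombination_notMem_unimodular hf hg hfg hs0 hs1,
    LipDaugavet.nonempty_totalSeq, fun x => ?_⟩
  have hnot := LipDaugavet.not_metricallyConvex_M x
  have halmost := LipDaugavet.almostMetricallyConvex_M x
  refine ⟨⟨1, 2, one_pos, two_pos, fun f => ⟨?_, LipDaugavet.norm_le_two_mul_norm_toL1 x f⟩⟩,
    LipDaugavet.strictConvexSpace_renormedL1 x, LipDaugavet.completeSpace_M x,
    fun _ => hnot halmost.metricallyConvex, halmost, hnot⟩
  rw [one_mul]
  exact LipDaugavet.norm_toL1_le x f
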